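/- Let $K$ be a field, let $n>m\ge 2$ be integers, let $d=\gcd(n,m)$, and let $S=K[x_1,\ldots,x_n]$ with its standard $\mathbb Z^n$-grading. Let $J_{n,m}\subset S$ be the $m$-path ideal of the cycle graph of length $n$, i.e. the ideal generated by the $n$ monomials $x_ix_{i+1}\cdots x_{i+m-1}$, $1\le i\le n$, with indices taken modulo $n$. Let $t_0=t_0(n,m)$ be the maximal integer such that $t_0\le n-1$ and there exists a positive integer $\alpha$ with $$mt_0=\alpha n+d.$$ For a nonzero monomial ideal $I\subset S$, a Stanley decomposition of $I$ is a finite direct sum decomposition $\mathcal D: I=\bigoplus_{i=1}^r u_iK[Z_i]$ of $\mathbb Z^n$-graded $K$-vector spaces, where each $u_i\in I$ is nonzero and homogeneous with respect to the $\mathbb Z^n$-grading and $Z_i\subseteq\{x_1,\ldots,x_n\}$; the Stanley depth $\operatorname{sdepth}(I)$ is the maximum, over all Stanley decompositions $\mathcal D$ of $I$, of $\min_{1\le i\le r}|Z_i|$. Then, for every integer $t\ge t_0$, $$\operatorname{sdepth}(J_{n,m}^t)\le\left\lfloor\frac{n+d}{2}\right\rfloor .$$ -/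

import Mathlib

/-- A Stanley decomposition of an ideal `I` of `S = K[x_i : i ∈ σ]`, where `S` carries its standard
multigrading (so that a homogeneous element of `S` is a scalar multiple of a monomial):
a finite direct sum decomposition `I = ⨁ i, u_i K[Z_i]` into multigraded `K`-subspaces, with each
`u_i` homogeneous and `u_i K[Z_i]` a free `K[Z_i]`-module (which, `S` being a domain, means
`u_i ≠ 0`). -/
structure StanleyDecomposition {σ : Type*} {K : Type*} [Field K]
    (I : Ideal (MvPolynomial σ K)) where
  /-- the number of summands -/
  r : ℕ
  /-- the homogeneous generators of the summands -/
  u : Fin r → MvPolynomial σ K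
  /-- the sets of variables -/
  Z : Fin r → Finset σ
  homogeneous : ∀ i, ∃ (a : σ →₀ ℕ) (c : K), u i = MvPolynomial.monomial a c
  ne_zero : ∀ i, u i ≠ 0
  /-- the sum of the subspaces `u_i K[Z_i]` is direct -/
  independent : iSupIndep fun i =>
    (Subalgebra.toSubmodule (MvPolynomial.supported K (Z i : Set σ))).map
      (LinearMap.mulLeft K (u i))
  /-- the subspaces `u_i K[Z_i]` together span `I` -/
  iSup_eq : (⨆ i, (Subalgebra.toSubmodule (MvPolynomial.supported K (Z i : Set σ))).map
      (LinearMap.mulLeft K (u i))) = I.restrictScalars K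

/-- The Stanley depth of a decomposition, `min_i |Z_i|` (it is `⊤` only for the decomposition of the
zero ideal without summands). -/
noncomputable def StanleyDecomposition.sdepth {σ : Type*} {K : Type*} [Field K]
    {I : Ideal (MvPolynomial σ K)} (D : StanleyDecomposition I) : ℕ∞ :=
  ⨅ i, ((D.Z i).card : ℕ∞)

/-- The Stanley depth of an ideal: the maximum of the Stanley depths of its Stanley
decompositions. -/
noncomputable def Ideal.sdepth {σ : Type*} {K : Type*} [Field K]
    (I : Ideal (MvPolynomial σ K)) : ℕ∞ :=
  ⨆ D : StanleyDecomposition I, D.sdepth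

/-- The `m`-path ideal `J_{n,m}` of the `n`-cycle, generated by the `n` products
`x_i x_{i+1} ⋯ x_{i+m-1}` of `m` cyclically consecutive variables (indices modulo `n`; the
variables are numbered `0, …, n-1`). -/
noncomputable def cyclePathIdeal (K : Type*) [Field K] (n m : ℕ) :
    Ideal (MvPolynomial (Fin n) K) :=
  Ideal.span (Set.range fun i : Fin n =>
    ∏ j ∈ Finset.range m, MvPolynomial.X ⟨(i.val + j) % n, Nat.mod_lt _ i.pos⟩)

/-- The integers `t ≤ n - 1` such that `m t = α n + gcd(n, m)` for some positive integer `α`. -/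
def cycleThresholdSet (n m : ℕ) : Set ℕ :=
  {t | t ≤ n - 1 ∧ ∃ α : ℕ, 0 < α ∧ m * t = α * n + Nat.gcd n m}

/-- The integer `t₀(n, m)`: the largest element of `cycleThresholdSet n m`. -/
noncomputable def cycleThreshold (n m : ℕ) : ℕ :=
  sSup (cycleThresholdSet n m)

/-- For `n > m ≥ 2` the maximum defining `t₀(n, m)` exists. -/
theorem isGreatest_cycleThreshold (n m : ℕ) (hm : 2 ≤ m) (hmn : m < n) :
    IsGreatest (cycleThresholdSet n m) (cycleThreshold n m) := by
  have hbdd : BddAbove (cycleThresholdSet n m) := ⟨n - 1, fun t ht => ht.1⟩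
  refine ⟨Nat.sSup_mem ?_ hbdd, fun t ht => le_csSup hbdd ht⟩
  by_cases hdvd : m ∣ n
  · obtain ⟨k, rfl⟩ := hdvd
    have hk : 2 ≤ k := by
      by_contra h
      have : k ≤ 1 := by omega
      nlinarith
    obtain ⟨a, rfl⟩ : ∃ a, m = a + 1 := ⟨m - 1, by omega⟩
    refine ⟨1 + a * k, ?_, a, by omega, ?_⟩
    · apply Nat.le_sub_one_of_lt
      nlinarith
    · rw [Nat.gcd_eq_right (Dvd.intro k rfl)]
      ring
  · have hg : Nat.gcd m n < n := lt_of_le_of_lt (Nat.gcd_le_left n (by omega)) hmn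
    obtain ⟨s, hlt, hs⟩ := Nat.exists_mul_mod_eq_gcd hg
    have hdm := Nat.div_add_mod (m * s) n
    rw [hs] at hdm
    refine ⟨s, by omega, m * s / n, ?_, ?_⟩
    · rcases Nat.eq_zero_or_pos (m * s / n) with h0 | h0
      · exfalso
        rw [h0, mul_zero, zero_add] at hdm
        exact hdvd ((Dvd.intro _ hdm.symm).trans (Nat.gcd_dvd_right m n))
      · exact h0
    · rw [Nat.gcd_comm n m, mul_comm _ n]
      exact hdm.symm

/-!
Let `d = gcd(n, m)` and call a transversal a choice of one variable in each class of indices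
modulo `d`. Since steps of length `m` move every index to every index of the same class, the
elements of a transversal are joined in the order of their classes by arcs whose lengths are
multiples of `m`, each arc ending one step past the start of the next. These arcs make up a closed
walk that covers every vertex equally often, except that the transversal is covered once more. So
for a suitable monomial `x^w` the product of `x^w` with every transversal monomial lies in `J^t`,
and counting degrees in each class shows that `J^t : x^w` is generated by the transversal
monomials.

Given a Stanley decomposition of such an ideal, exchanging the variable `z` with the element of
the transversal `T` in the class of `z` is an involution of the pairs `(T, z)` that preserves `x^w
x^T z`. Take the pairs for which `z` is a free variable of the summand containing `x^w x^T`. Two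
of them that are exchanged lie in the same summand, which then contains the greatest common
divisor of the two transversal monomials times `x^w`, and this is not in the ideal unless the
pairs are equal. So at most half of the pairs, plus half of the fixed pairs, are of this kind; as
there are `n` pairs and `d` fixed pairs for each `T`, the average number of free variables is at
most `(n + d) / 2`.
-/

open MvPolynomial Finset

section Cells

variable {σ : Type*}

/-- The exponents of the monomials of a Stanley space `x^a K[Z]`. -/
def stanleyCell (a : σ →₀ ℕ) (Z : Finset σ) : Set (σ →₀ ℕ) :=
  {b | a ≤ b ∧ ∀ z ∉ Z, b z = a z}

theorem add_single_mem_stanleyCell {a b : σ →₀ ℕ} {Z : Finset σ} (hb : b ∈ stanleyCell a Z)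
    {z : σ} (hz : z ∈ Z) (k : ℕ) : b + Finsupp.single z k ∈ stanleyCell a Z := by
  refine ⟨hb.1.trans le_self_add, fun y hy => ?_⟩
  have hzy : y ≠ z := by
    rintro rfl
    exact hy hz
  simp [hb.2 y hy, hzy]

theorem infClosed_stanleyCell (a : σ →₀ ℕ) (Z : Finset σ) : InfClosed (stanleyCell a Z) :=
  fun b hb b' hb' => ⟨le_inf hb.1 hb'.1, fun z hz => by simp [hb.2 z hz, hb'.2 z hz]⟩

theorem map_mulLeft_supported {K : Type*} [Field K] (a : σ →₀ ℕ) {c : K} (hc : c ≠ 0)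
    (Z : Finset σ) :
    (Subalgebra.toSubmodule (supported K (Z : Set σ))).map (LinearMap.mulLeft K (monomial a c)) =
      restrictSupport K (stanleyCell a Z) := by
  classical
  apply le_antisymm
  · rintro _ ⟨q, hq, rfl⟩ b hb
    have hcoeff : coeff b (monomial a c * q) ≠ 0 := mem_support_iff.1 hb
    rw [coeff_monomial_mul'] at hcoeff
    obtain ⟨hab, hne⟩ := ite_ne_right_iff.1 hcoeff
    refine ⟨hab, fun z hz => ?_⟩
    by_contra hbz
    have hlt : a z < b z := lt_of_le_of_ne (hab z) (Ne.symm hbz)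
    refine hz (mem_supported.1 hq ((mem_vars_iff_mem_support z).2
      ⟨b - a, mem_support_iff.2 (right_ne_zero_of_mul hne), ?_⟩))
    rw [Finsupp.mem_support_iff, Finsupp.tsub_apply]
    exact (Nat.sub_pos_of_lt hlt).ne'
  · rw [restrictSupport_eq_span, Submodule.span_le]
    rintro _ ⟨b, hb, rfl⟩
    refine ⟨monomial (b - a) c⁻¹, mem_supported.2 ?_, ?_⟩
    · intro z hz
      rw [mem_coe, vars_monomial (inv_ne_zero hc), Finsupp.mem_support_iff,
        Finsupp.tsub_apply] at hz
      by_contra hzZ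
      exact hz (by rw [hb.2 z hzZ, Nat.sub_self])
    · simp [monomial_mul, add_tsub_cancel_of_le hb.1, hc]

end Cells

namespace StanleyDecomposition

variable {σ K : Type*} [Field K] {I : Ideal (MvPolynomial σ K)} (D : StanleyDecomposition I)

/-- The exponents of the monomials in the `i`-th summand of a Stanley decomposition. -/
noncomputable def cell (i : Fin D.r) : Set (σ →₀ ℕ) :=
  stanleyCell (D.homogeneous i).choose (D.Z i)

theorem map_mulLeft_eq_restrictSupport_cell (i : Fin D.r) :
    (Subalgebra.toSubmodule (supported K (D.Z i : Set σ))).map (LinearMap.mulLeft K (D.u i)) =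
      restrictSupport K (D.cell i) := by
  obtain ⟨c, hu⟩ := (D.homogeneous i).choose_spec
  have hc : c ≠ 0 := by
    rintro rfl
    exact D.ne_zero i (by simpa using hu)
  rw [cell, ← map_mulLeft_supported _ hc, ← hu]

theorem restrictSupport_iUnion_cell :
    restrictSupport K (⋃ i, D.cell i) = I.restrictScalars K := by
  simp_rw [← D.iSup_eq, map_mulLeft_eq_restrictSupport_cell, restrictSupport_eq_span,
    Set.image_iUnion, Submodule.span_iUnion]

theorem mem_iUnion_cell {b : σ →₀ ℕ} : b ∈ ⋃ i, D.cell i ↔ monomial b (1 : K) ∈ I := by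
  rw [← Submodule.restrictScalars_mem K, ← restrictSupport_iUnion_cell,
    monomial_mem_restrictSupport, or_iff_left one_ne_zero]

theorem pairwise_disjoint_cell : Pairwise (Function.onFun Disjoint D.cell) := by
  intro i j hij
  have hdisj := D.independent.pairwiseDisjoint hij
  rw [Function.onFun, map_mulLeft_eq_restrictSupport_cell, map_mulLeft_eq_restrictSupport_cell,
    Submodule.disjoint_def] at hdisj
  refine Set.disjoint_left.2 fun b hi hj => one_ne_zero (α := K) ?_
  exact monomial_eq_zero.1 <| hdisj (monomial b 1) ((monomial_mem_restrictSupport K).2 (.inl hi))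
    ((monomial_mem_restrictSupport K).2 (.inl hj))

theorem monomial_inf_mem {i j : Fin D.r} {b b' : σ →₀ ℕ} {x y : σ}
    (hb : b ∈ D.cell i) (hx : x ∈ D.Z i) (hb' : b' ∈ D.cell j) (hy : y ∈ D.Z j)
    (h : b + Finsupp.single x 1 = b' + Finsupp.single y 1) : monomial (b ⊓ b') (1 : K) ∈ I := by
  have hij : i = j := by
    by_contra hij
    refine Set.disjoint_left.1 (D.pairwise_disjoint_cell hij)
      (add_single_mem_stanleyCell hb hx 1) ?_
    rw [h]
    exact add_single_mem_stanleyCell hb' hy 1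
  subst hij
  exact D.mem_iUnion_cell.1 (Set.mem_iUnion_of_mem i (infClosed_stanleyCell _ _ hb hb'))

end StanleyDecomposition

theorem two_mul_card_le_card_add_card_fixedPoints {α : Type*} [Fintype α] [DecidableEq α]
    {f : α → α} (hf : Function.Injective f) {s : Finset α} (hs : ∀ x ∈ s, f x ∈ s → f x = x) :
    2 * #s ≤ Fintype.card α + #{x | f x = x} := by
  have hinter : s ∩ s.image f ⊆ ({x | f x = x} : Finset α) := by
    intro y hy
    obtain ⟨hy, x, hx, rfl⟩ := by simpa only [mem_inter, mem_image] using hy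
    simp [hs x hx hy]
  calc 2 * #s = #s + #(s.image f) := by rw [card_image_of_injective s hf, two_mul]
    _ = #(s ∪ s.image f) + #(s ∩ s.image f) := (card_union_add_card_inter _ _).symm
    _ ≤ Fintype.card α + #{x | f x = x} := add_le_add (card_le_univ _) (card_le_card hinter)

/-- The sections of `p : σ → ι`. Each of them chooses one element in each class of the partition of
`σ` into the fibres of `p`; here `σ` indexes the variables of a polynomial ring. -/
abbrev Transversal {σ ι : Type*} (p : σ → ι) : Type _ :=
  {J : ι → σ // Function.RightInverse J p}

namespace Transversal

variable {σ ι : Type*} {p : σ → ι}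

section Exchange

variable [DecidableEq ι]

/-- Replaces the element of the transversal `x.1` in the class of `x.2` by `x.2`, and keeps the
replaced element as the second component. -/
def exchange (x : Transversal p × σ) : Transversal p × σ :=
  (⟨Function.update x.1.1 (p x.2) x.2, fun r => by
    obtain rfl | hr := eq_or_ne r (p x.2)
    · simp
    · simp [hr, x.1.2 r]⟩, x.1.1 (p x.2))

theorem exchange_involutive : Function.Involutive (exchange (p := p)) := by
  rintro ⟨⟨J, hJ⟩, l⟩
  simp [exchange, hJ (p l)]

theorem card_fixedPoints_exchange_le [Fintype ι] [Fintype (Transversal p)]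
    [DecidableEq (Transversal p × σ)] [Fintype σ] :
    #{x : Transversal p × σ | exchange x = x} ≤ Fintype.card (Transversal p) * Fintype.card ι := by
  rw [← Fintype.card_prod, ← card_univ]
  refine card_le_card_of_injOn (fun x => (x.1, p x.2)) (fun _ _ => mem_univ _) ?_
  intro x hx y hy hxy
  have hfixed {z : Transversal p × σ} (hz : exchange z = z) : z.1.1 (p z.2) = z.2 :=
    congrArg Prod.snd hz
  obtain ⟨hJ, hp⟩ := Prod.mk.inj hxy
  refine Prod.ext hJ ?_
  rw [← hfixed (mem_filter.1 hx).2, ← hfixed (mem_filter.1 hy).2, hp, hJ]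

end Exchange

variable [Fintype ι]

/-- The exponent of the product of the variables chosen by a transversal. -/
noncomputable def exponent (J : Transversal p) : σ →₀ ℕ := ∑ r, Finsupp.single (J.1 r) 1

theorem exponent_apply [DecidableEq σ] (J : Transversal p) (z : σ) :
    J.exponent z = if J.1 (p z) = z then 1 else 0 := by
  simp only [exponent, Finsupp.finsetSum_apply, Finsupp.single_apply]
  rw [Fintype.sum_eq_single (p z)]
  intro r hr
  refine if_neg ?_
  rintro rfl
  exact hr (J.2 r).symm

theorem surjOn_support_exponent (J : Transversal p) :
    Set.SurjOn p J.exponent.support Set.univ := by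
  classical
  exact fun r _ => ⟨J.1 r, by simp [exponent_apply, J.2 r], J.2 r⟩

theorem exists_exponent_le {c : σ →₀ ℕ} (hc : Set.SurjOn p c.support Set.univ) :
    ∃ J : Transversal p, J.exponent ≤ c := by
  classical
  choose J hJsupp hJ using fun r => hc (Set.mem_univ r)
  refine ⟨⟨J, hJ⟩, fun z => ?_⟩
  rw [exponent_apply]
  split_ifs with hz
  · exact Nat.one_le_iff_ne_zero.2 (Finsupp.mem_support_iff.1 (hz ▸ hJsupp (p z)))
  · exact Nat.zero_le _

theorem exponent_add_single_exchange [DecidableEq ι] (x : Transversal p × σ) :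
    (exchange x).1.exponent + Finsupp.single (exchange x).2 1 =
      x.1.exponent + Finsupp.single x.2 1 := by
  obtain ⟨⟨J, hJ⟩, l⟩ := x
  simp only [exponent, exchange]
  rw [← add_sum_erase _ _ (mem_univ (p l)), ← add_sum_erase _ _ (mem_univ (p l)),
    Function.update_self, sum_congr rfl fun r hr => by
      rw [Function.update_of_ne (ne_of_mem_erase hr)]]
  abel

/-- If the exchange is not trivial, the two transversals have disjoint traces on the class of the
exchanged elements. -/
theorem not_surjOn_support_inf_exchange [DecidableEq ι] {x : Transversal p × σ}
    (hx : exchange x ≠ x) :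
    ¬ Set.SurjOn p (x.1.exponent ⊓ (exchange x).1.exponent).support Set.univ := by
  classical
  intro hsurj
  obtain ⟨z, hz, hzl⟩ := hsurj (Set.mem_univ (p x.2))
  obtain ⟨hJz, hlz⟩ : x.1.1 (p x.2) = z ∧ x.2 = z := by
    simpa [exponent_apply, exchange, hzl, Nat.min_eq_zero_iff] using hz
  apply hx
  have hl : x.1.1 (p x.2) = x.2 := hJz.trans hlz.symm
  refine Prod.ext (Subtype.ext ?_) hl
  simp only [exchange]
  rw [Function.update_eq_self_iff, hl]

end Transversal

theorem StanleyDecomposition.two_mul_le_card_add_card {σ ι K : Type*} [Field K] [Fintype σ]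
    [Fintype ι] {I : Ideal (MvPolynomial σ K)} (D : StanleyDecomposition I) {k : ℕ}
    (hk : ∀ i, k ≤ #(D.Z i)) {p : σ → ι} (hp : Function.Surjective p) (w : σ →₀ ℕ)
    (hI : ∀ c, monomial (w + c) (1 : K) ∈ I ↔ Set.SurjOn p c.support Set.univ) :
    2 * k ≤ Fintype.card σ + Fintype.card ι := by
  classical
  choose cellOf hcellOf using fun J : Transversal p =>
    Set.mem_iUnion.1 (D.mem_iUnion_cell.2 ((hI _).2 J.surjOn_support_exponent))
  let A : Finset (Transversal p × σ) := {x | x.2 ∈ D.Z (cellOf x.1)}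
  have hA : ∀ x ∈ A, Transversal.exchange x ∈ A → Transversal.exchange x = x := by
    intro x hx hx'
    by_contra hne
    refine Transversal.not_surjOn_support_inf_exchange hne ((hI _).1 ?_)
    have hinf (c c' : σ →₀ ℕ) : w + c ⊓ c' = (w + c) ⊓ (w + c') :=
      Finsupp.ext fun z => (min_add_add_left (w z) (c z) (c' z)).symm
    rw [hinf]
    refine D.monomial_inf_mem (hcellOf _) (mem_filter.1 hx).2 (hcellOf _) (mem_filter.1 hx').2 ?_
    rw [add_assoc, add_assoc, Transversal.exponent_add_single_exchange]
  have hcardA : Fintype.card (Transversal p) * k ≤ #A := by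
    rw [card_filter, Fintype.sum_prod_type, ← smul_eq_mul]
    refine card_nsmul_le_sum _ _ _ fun J _ => ?_
    simpa using hk (cellOf J)
  have hpos : 0 < Fintype.card (Transversal p) :=
    Fintype.card_pos_iff.2 ⟨_, hp.hasRightInverse.choose_spec⟩
  refine Nat.le_of_mul_le_mul_left ?_ hpos
  calc Fintype.card (Transversal p) * (2 * k) = 2 * (Fintype.card (Transversal p) * k) := by ring
    _ ≤ 2 * #A := by gcongr
    _ ≤ Fintype.card (Transversal p × σ) + #{x : Transversal p × σ | Transversal.exchange x = x} :=
      two_mul_card_le_card_add_card_fixedPoints Transversal.exchange_involutive.injective hA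
    _ ≤ Fintype.card (Transversal p × σ) + Fintype.card (Transversal p) * Fintype.card ι := by
      gcongr
      exact Transversal.card_fixedPoints_exchange_le
    _ = Fintype.card (Transversal p) * (Fintype.card σ + Fintype.card ι) := by
      rw [Fintype.card_prod, mul_add]

/-- The hypothesis on `w` says that `I : x^w` is the intersection of the prime ideals generated by
the variables of the fibres of `p`. -/
theorem sdepth_le_of_colon_monomial {σ ι K : Type*} [Field K] [Fintype σ] [Fintype ι]
    {I : Ideal (MvPolynomial σ K)} {p : σ → ι} (hp : Function.Surjective p) (w : σ →₀ ℕ)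
    (hI : ∀ c, monomial (w + c) (1 : K) ∈ I ↔ Set.SurjOn p c.support Set.univ) :
    I.sdepth ≤ ((Fintype.card σ + Fintype.card ι) / 2 : ℕ) := by
  refine iSup_le fun D => ?_
  by_contra! hlt
  have hk (i) : (Fintype.card σ + Fintype.card ι) / 2 + 1 ≤ #(D.Z i) := by
    exact_mod_cast hlt.trans_le (iInf_le _ i)
  have := D.two_mul_le_card_add_card hk hp w hI
  omega

section Rees

/-- The graded monoid of the pairs `(t, c)` such that `c` is a sum of `t` terms `a i`. If the `a i`
are the exponents of the generators of a monomial ideal, these are the exponents of the products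
of `t` generators, that is, of the generators `T^t x^c` of its Rees algebra. -/
def reesMonoid {ι M : Type*} [AddCommMonoid M] (a : ι → M) : AddSubmonoid (ℕ × M) :=
  AddSubmonoid.closure (Set.range fun i => (1, a i))

theorem mk_one_mem_reesMonoid {ι M : Type*} [AddCommMonoid M] (a : ι → M) (i : ι) :
    (1, a i) ∈ reesMonoid a :=
  AddSubmonoid.subset_closure ⟨i, rfl⟩

theorem map_eq_nsmul_of_mem_reesMonoid {ι M N : Type*} [AddCommMonoid M] [AddCommMonoid N]
    {a : ι → M} (f : M →+ N) {q : N} (hf : ∀ i, f (a i) = q) {x : ℕ × M} (hx : x ∈ reesMonoid a) :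
    f x.2 = x.1 • q := by
  induction hx using AddSubmonoid.closure_induction with
  | mem x hx =>
    obtain ⟨i, rfl⟩ := hx
    simp [hf]
  | zero => simp
  | add x y _ _ hx hy => simp [hx, hy, add_smul]

variable {ι σ R : Type*} [CommSemiring R] (a : ι → σ →₀ ℕ)

theorem span_range_monomial_pow (t : ℕ) :
    Ideal.span (Set.range fun i => monomial (a i) (1 : R)) ^ t =
      Ideal.span ((fun c => monomial c 1) '' {c | (t, c) ∈ reesMonoid a}) := by
  apply le_antisymm
  · induction t with
    | zero =>
      rw [pow_zero, Ideal.one_eq_top, top_le_iff, Ideal.eq_top_iff_one]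
      exact Ideal.subset_span ⟨0, zero_mem (reesMonoid a), rfl⟩
    | succ t ih =>
      rw [pow_succ]
      refine (Ideal.mul_mono_left ih).trans ?_
      rw [Ideal.span_mul_span', Ideal.span_le]
      rintro _ ⟨_, ⟨c, hc, rfl⟩, _, ⟨i, rfl⟩, rfl⟩
      refine Ideal.subset_span ⟨c + a i, add_mem hc (mk_one_mem_reesMonoid a i), ?_⟩
      simp [monomial_mul]
  · rw [Ideal.span_le]
    rintro _ ⟨c, hc, rfl⟩
    suffices h : ∀ x ∈ reesMonoid a, monomial x.2 (1 : R) ∈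
        Ideal.span (Set.range fun i => monomial (a i) (1 : R)) ^ x.1 from h _ hc
    intro x hx
    induction hx using AddSubmonoid.closure_induction with
    | mem x hx =>
      obtain ⟨i, rfl⟩ := hx
      rw [pow_one]
      exact Ideal.subset_span ⟨i, rfl⟩
    | zero => simp
    | add x y _ _ hx hy =>
      have hmul : monomial (x + y).2 (1 : R) = monomial x.2 1 * monomial y.2 1 := by
        rw [monomial_mul, one_mul, Prod.snd_add]
      rw [hmul, Prod.fst_add, pow_add]
      exact Ideal.mul_mem_mul hx hy

theorem monomial_mem_span_range_monomial_pow [Nontrivial R] {t : ℕ} {b : σ →₀ ℕ} :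
    monomial b (1 : R) ∈ Ideal.span (Set.range fun i => monomial (a i) (1 : R)) ^ t ↔
      ∃ c ≤ b, (t, c) ∈ reesMonoid a := by
  classical
  rw [span_range_monomial_pow, mem_ideal_span_monomial_image]
  simp [support_monomial, and_comm]

end Rees

section Walk

variable {M : Type*} [AddCommMonoid M]

/-- The sum of the `m` consecutive terms of the sequence `e` that start at `s`. -/
def windowSum (e : ℕ → M) (m s : ℕ) : M := ∑ j ∈ range m, e (s + j)

theorem windowSum_add (e : ℕ → M) (a b s : ℕ) :
    windowSum e (a + b) s = windowSum e a s + windowSum e b (s + a) := by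
  simp only [windowSum, sum_range_add, add_assoc]

theorem mk_windowSum_mul_mem_reesMonoid (e : ℕ → M) (m l s : ℕ) :
    (l, windowSum e (m * l) s) ∈ reesMonoid (windowSum e m) := by
  induction l with
  | zero => exact zero_mem _
  | succ l ih =>
    rw [Nat.mul_succ, windowSum_add]
    exact add_mem ih (mk_one_mem_reesMonoid _ _)

theorem windowSum_mul_add_of_periodic {e : ℕ → M} {n : ℕ} (he : Function.Periodic e n)
    (a b s : ℕ) : windowSum e (n * a + b) s = a • windowSum e n s + windowSum e b s := by
  induction a with
  | zero => simp
  | succ a ih =>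
    have hshift : windowSum e (n * a + b) (s + n) = windowSum e (n * a + b) s :=
      sum_congr rfl fun j _ => by rw [add_right_comm, he]
    rw [show n * (a + 1) + b = n + (n * a + b) by ring, windowSum_add, hshift, ih, succ_nsmul']
    abel

/-- The arcs of a closed walk on the cycle of length `n`, where each arc ends one step past the
start of the next one: they cover the cycle uniformly, except that each starting point is covered
once more. -/
theorem sum_windowSum_closed_walk [IsCancelAdd M] {κ : Type*} [Fintype κ] {e : ℕ → M} {n : ℕ}
    (he : Function.Periodic e n) (π : Equiv.Perm κ) {J ℓ a : κ → ℕ}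
    (h : ∀ r, J r + ℓ r = J (π r) + 1 + n * a r) :
    ∑ r, windowSum e (ℓ r) (J r) = (∑ r, a r) • windowSum e n 0 + ∑ r, e (J r) := by
  have harc (r) : windowSum e (J r) 0 + windowSum e (ℓ r) (J r) =
      a r • windowSum e n 0 + e (J (π r)) + windowSum e (J (π r)) 0 := by
    calc windowSum e (J r) 0 + windowSum e (ℓ r) (J r)
        = windowSum e (n * a r + (J (π r) + 1)) 0 := by
          rw [add_comm (n * a r), ← h, windowSum_add, zero_add]
      _ = a r • windowSum e n 0 + e (J (π r)) + windowSum e (J (π r)) 0 := by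
          rw [windowSum_mul_add_of_periodic he, windowSum_add, zero_add, add_assoc]
          simp [windowSum, add_comm]
  have hsum := sum_congr (rfl : (univ : Finset κ) = univ) fun r _ => harc r
  simp only [sum_add_distrib] at hsum
  rw [Equiv.sum_comp π fun r => e (J r), Equiv.sum_comp π fun r => windowSum e (J r) 0,
    add_comm] at hsum
  rw [sum_smul]
  exact add_right_cancel hsum

theorem exists_add_mul_eq_add_mul {n m x y : ℕ} (hn : 0 < n) (hm : 0 < m) (hy : y ≤ n)
    (hxy : x ≡ y [MOD n.gcd m]) :
    ∃ l a, 0 < l ∧ l ≤ n / n.gcd m ∧ x + m * l = y + n * a := by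
  obtain ⟨N, hN⟩ := Nat.gcd_dvd_left n m
  obtain ⟨M, hM⟩ := Nat.gcd_dvd_right n m
  have hd : 0 < n.gcd m := Nat.gcd_pos_of_pos_left m hn
  have hNpos : (0 : ℤ) < N := by exact_mod_cast Nat.pos_of_mul_pos_left (hN ▸ hn)
  have hmN : (m : ℤ) * N = n * M := by
    exact_mod_cast show m * N = n * M by
      calc m * N = n.gcd m * M * N := by rw [← hM]
        _ = n.gcd m * N * M := by ring
        _ = n * M := by rw [← hN]
  obtain ⟨f, hf⟩ := hxy.dvd
  obtain ⟨q, ⟨hl0, hlN⟩, -⟩ := existsUnique_add_zsmul_mem_Ioc hNpos (n.gcdB m * f) 0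
  rw [smul_eq_mul] at hl0 hlN
  have heq : x + m * (n.gcdB m * f + q * N) = y + n * (q * M - n.gcdA m * f) := by
    linear_combination -hf - f * Nat.gcd_eq_gcd_ab n m + q * hmN
  have ha : 0 ≤ q * M - n.gcdA m * f := by
    have hpos : 0 < (m : ℤ) * (n.gcdB m * f + q * N) := mul_pos (by exact_mod_cast hm) hl0
    have hlt : (n : ℤ) * (-1) < n * (q * M - n.gcdA m * f) := by omega
    have := lt_of_mul_lt_mul_left hlt (by positivity)
    omega
  lift n.gcdB m * f + q * N to ℕ using hl0.le with l
  lift q * M - n.gcdA m * f to ℕ using ha with a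
  refine ⟨l, a, by exact_mod_cast hl0, ?_, by exact_mod_cast heq⟩
  rw [Nat.div_eq_of_eq_mul_right hd hN]
  omega

end Walk

section CyclePathIdeal

theorem le_cycleThreshold {n m α L : ℕ} (hm : 2 ≤ m) (hmn : m < n) (hdL : n.gcd m ≤ L)
    (hLn : L ≤ n) (h : m * L = α * n + n.gcd m) : L ≤ cycleThreshold n m := by
  have hd : 0 < n.gcd m := Nat.gcd_pos_of_pos_right n (by omega)
  have hdm : n.gcd m ≤ m := Nat.gcd_le_right n (by omega)
  refine (isGreatest_cycleThreshold n m hm hmn).2 ⟨Nat.le_sub_one_of_lt (hLn.lt_of_ne ?_), α, ?_, h⟩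
  · rintro rfl
    have hdvd : L ∣ L.gcd m := (Nat.dvd_add_right ⟨α, mul_comm α L⟩).1 ⟨m, by rw [← h, mul_comm]⟩
    exact (hdm.trans_lt hmn).not_ge (Nat.le_of_dvd hd hdvd)
  · rw [Nat.pos_iff_ne_zero]
    rintro rfl
    nlinarith

/-- The residue class modulo `d` of the index of a vertex of the `n`-cycle. It is used for `d ∣ n`,
where it is compatible with the cyclic order. -/
def vertexClass (n d : ℕ) (l : Fin n) : ZMod d := (l.val : ZMod d)

theorem vertexClass_surjective {n d : ℕ} [NeZero d] (hd : d ≤ n) :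
    Function.Surjective (vertexClass n d) :=
  fun r => ⟨⟨r.val, (ZMod.val_lt r).trans_le hd⟩, ZMod.natCast_zmod_val r⟩

/-- The degree in the variables of one residue class. -/
noncomputable def classDegree {n : ℕ} (d : ℕ) (r : ZMod d) : (Fin n →₀ ℕ) →+ ℕ :=
  (Finsupp.applyAddHom r).comp (Finsupp.mapDomain.addMonoidHom (vertexClass n d))

theorem surjOn_support_of_classDegree_pos {n d : ℕ} {c : Fin n →₀ ℕ}
    (hc : ∀ r, 0 < classDegree d r c) : Set.SurjOn (vertexClass n d) c.support Set.univ := by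
  classical
  intro r _
  have hr := Finsupp.mapDomain_support (Finsupp.mem_support_iff.2 (hc r).ne')
  exact_mod_cast hr

variable {n : ℕ} [NeZero n]

theorem vertexClass_ofNat {d : ℕ} (hd : d ∣ n) (s : ℕ) : vertexClass n d (Fin.ofNat n s) = s :=
  (ZMod.natCast_eq_natCast_iff _ _ _).2 ((Nat.mod_modEq s n).of_dvd hd)

variable (n) in
/-- The exponent of the variable with index `s` modulo `n`. -/
noncomputable def cycleVar (s : ℕ) : Fin n →₀ ℕ := Finsupp.single (Fin.ofNat n s) 1

theorem periodic_cycleVar : Function.Periodic (cycleVar n) n := by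
  intro s
  simp [cycleVar, Fin.ofNat]

theorem cycleVar_val (l : Fin n) : cycleVar n l = Finsupp.single l 1 := by
  simp [cycleVar]

theorem cyclePathIdeal_eq_span (K : Type*) [Field K] (m : ℕ) :
    cyclePathIdeal K n m =
      Ideal.span (Set.range fun s => monomial (windowSum (cycleVar n) m s) (1 : K)) := by
  have hwindow (s : ℕ) : monomial (windowSum (cycleVar n) m s) (1 : K) =
      ∏ j ∈ range m, X ⟨(s + j) % n, Nat.mod_lt _ (Nat.pos_of_neZero n)⟩ := by
    rw [windowSum, monomial_sum_one]
    rfl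
  rw [cyclePathIdeal]
  congr 1
  ext p
  constructor
  · rintro ⟨i, rfl⟩
    exact ⟨i, hwindow i⟩
  · rintro ⟨s, rfl⟩
    exact ⟨Fin.ofNat n s, by simp [hwindow]⟩

theorem classDegree_windowSum {d ℓ : ℕ} [NeZero d] (hdn : d ∣ n) (hdℓ : d ∣ ℓ) (r : ZMod d)
    (s : ℕ) : classDegree d r (windowSum (cycleVar n) ℓ s) = ℓ / d := by
  have hterm (j : ℕ) : classDegree d r (cycleVar n (s + j)) =
      if j ≡ (r - s).val [MOD d] then 1 else 0 := by
    have hiff : ((s + j : ℕ) : ZMod d) = r ↔ j ≡ (r - s).val [MOD d] := by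
      rw [← ZMod.natCast_eq_natCast_iff, ZMod.natCast_zmod_val, eq_sub_iff_add_eq', Nat.cast_add]
    simp only [classDegree, cycleVar, AddMonoidHom.comp_apply, Finsupp.mapDomain.addMonoidHom_apply,
      Finsupp.mapDomain_single, Finsupp.applyAddHom_apply, vertexClass_ofNat hdn,
      Finsupp.single_apply, hiff]
  rw [windowSum, map_sum, sum_congr rfl fun j _ => hterm j, ← card_filter,
    ← Nat.count_eq_card_filter_range, Nat.count_modEq_card _ (Nat.pos_of_neZero d),
    Nat.mod_eq_zero_of_dvd hdℓ]
  simp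

variable {m : ℕ}

instance neZero_gcd : NeZero (n.gcd m) := ⟨(Nat.gcd_pos_of_pos_left m (Nat.pos_of_neZero n)).ne'⟩

theorem exists_closed_walk_mem_reesMonoid (hm : 0 < m) (J : Transversal (vertexClass n (n.gcd m))) :
    ∃ L A, n.gcd m ≤ L ∧ L ≤ n ∧ m * L = A * n + n.gcd m ∧
      (L, A • windowSum (cycleVar n) n 0 + J.exponent) ∈ reesMonoid (windowSum (cycleVar n) m) := by
  have hn : 0 < n := Nat.pos_of_neZero n
  have hclass (r : ZMod (n.gcd m)) : (((J.1 r).val : ℕ) : ZMod (n.gcd m)) = r := J.2 r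
  have hstep (r : ZMod (n.gcd m)) : ∃ l a, 0 < l ∧ l ≤ n / n.gcd m ∧
      (J.1 r).val + m * l = (J.1 (r - 1)).val + 1 + n * a := by
    refine exists_add_mul_eq_add_mul hn hm (J.1 (r - 1)).isLt ?_
    rw [← ZMod.natCast_eq_natCast_iff, Nat.cast_add, hclass, hclass, Nat.cast_one, sub_add_cancel]
  choose l a hl0 hlN hla using hstep
  have hcard : #(univ : Finset (ZMod (n.gcd m))) = n.gcd m := by rw [card_univ, ZMod.card]
  refine ⟨∑ r, l r, ∑ r, a r, ?_, ?_, ?_, ?_⟩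
  · simpa [hcard] using card_nsmul_le_sum univ l 1 fun r _ => hl0 r
  · calc ∑ r, l r ≤ n.gcd m * (n / n.gcd m) := by
          simpa [hcard] using sum_le_card_nsmul univ l _ fun r _ => hlN r
      _ = n := Nat.mul_div_cancel' (Nat.gcd_dvd_left n m)
  · have hsum := sum_congr (rfl : univ = univ) fun r _ => hla r
    simp only [sum_add_distrib, ← mul_sum, sum_const, hcard, smul_eq_mul, mul_one] at hsum
    have hshift : ∑ r, (J.1 (r - 1)).val = ∑ r, (J.1 r).val :=
      (Equiv.subRight 1).sum_comp fun r => (J.1 r).val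
    linarith
  · have hwalk := sum_windowSum_closed_walk periodic_cycleVar (Equiv.subRight 1) hla
    simp only [cycleVar_val] at hwalk
    rw [Transversal.exponent, ← hwalk, prod_mk_sum]
    exact sum_mem fun r _ => mk_windowSum_mul_mem_reesMonoid _ _ _ _

theorem smul_windowSum_add_exponent_mem_reesMonoid {α : ℕ} (hm : 2 ≤ m) (hmn : m < n)
    (hα : m * cycleThreshold n m = α * n + n.gcd m) (J : Transversal (vertexClass n (n.gcd m))) :
    (cycleThreshold n m, α • windowSum (cycleVar n) n 0 + J.exponent) ∈
      reesMonoid (windowSum (cycleVar n) m) := by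
  obtain ⟨L, A, hdL, hLn, hLA, hmem⟩ := exists_closed_walk_mem_reesMonoid (by omega) J
  obtain ⟨k, hk⟩ := Nat.exists_eq_add_of_le' (le_cycleThreshold hm hmn hdL hLn hLA)
  rw [hk, mul_add, hLA] at hα
  obtain ⟨B, rfl⟩ : ∃ B, α = B + A :=
    Nat.exists_eq_add_of_le' (Nat.le_of_mul_le_mul_right (by omega) (Nat.pos_of_neZero n))
  have hround : windowSum (cycleVar n) (m * k) 0 = B • windowSum (cycleVar n) n 0 := by
    rw [show m * k = n * B + 0 by linarith, windowSum_mul_add_of_periodic periodic_cycleVar]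
    simp [windowSum]
  have hsum := add_mem (mk_windowSum_mul_mem_reesMonoid (cycleVar n) m k 0) hmem
  rwa [hround, Prod.mk_add_mk, ← add_assoc, ← add_smul, ← hk] at hsum

theorem monomial_add_mem_cyclePathIdeal_pow_iff (K : Type*) [Field K] {α t : ℕ} (hm : 2 ≤ m)
    (hmn : m < n) (hα : m * cycleThreshold n m = α * n + n.gcd m) (ht : cycleThreshold n m ≤ t)
    (c : Fin n →₀ ℕ) :
    monomial (α • windowSum (cycleVar n) n 0 +
        (t - cycleThreshold n m) • windowSum (cycleVar n) m 0 + c) (1 : K) ∈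
      cyclePathIdeal K n m ^ t ↔ Set.SurjOn (vertexClass n (n.gcd m)) c.support Set.univ := by
  obtain ⟨k, rfl⟩ := Nat.exists_eq_add_of_le ht
  rw [cyclePathIdeal_eq_span, monomial_mem_span_range_monomial_pow, add_tsub_cancel_left]
  constructor
  · rintro ⟨b, hb, hmem⟩
    refine surjOn_support_of_classDegree_pos fun r => ?_
    have hdn := Nat.gcd_dvd_left n m
    have hdm := Nat.gcd_dvd_right n m
    have hdeg := map_eq_nsmul_of_mem_reesMonoid (classDegree (n.gcd m) r)
      (classDegree_windowSum hdn hdm r) hmem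
    obtain ⟨b', hb'⟩ := le_iff_exists_add.1 hb
    have hsum := congrArg (classDegree (n.gcd m) r) hb'
    have hα' : cycleThreshold n m * (m / n.gcd m) = α * (n / n.gcd m) + 1 := by
      rw [← Nat.mul_div_assoc _ hdm, ← Nat.mul_div_assoc _ hdn, mul_comm, hα,
        Nat.add_div_right _ (Nat.pos_of_neZero _)]
    simp only [map_add, map_nsmul, classDegree_windowSum hdn hdn, classDegree_windowSum hdn hdm,
      hdeg, smul_eq_mul, add_mul] at hsum
    omega
  · intro hc
    obtain ⟨J, hJ⟩ := Transversal.exists_exponent_le hc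
    refine ⟨_, add_le_add_right hJ _, ?_⟩
    rw [add_right_comm]
    simpa using add_mem (smul_windowSum_add_exponent_mem_reesMonoid hm hmn hα J)
      (nsmul_mem (mk_one_mem_reesMonoid (windowSum (cycleVar n) m) 0) k)

end CyclePathIdeal

theorem theorem4p5 (K : Type*) [Field K] (n m : ℕ) (hm : 2 ≤ m) (hmn : m < n)
    (t : ℕ) (ht : cycleThreshold n m ≤ t) :
    Ideal.sdepth (cyclePathIdeal K n m ^ t) ≤ (((n + Nat.gcd n m) / 2 : ℕ) : ℕ∞) := by
  have : NeZero n := ⟨by omega⟩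
  obtain ⟨-, α, -, hα⟩ := (isGreatest_cycleThreshold n m hm hmn).1
  have hsurj : Function.Surjective (vertexClass n (n.gcd m)) :=
    vertexClass_surjective (Nat.gcd_le_left m (Nat.pos_of_neZero n))
  simpa using sdepth_le_of_colon_monomial hsurj _
    (monomial_add_mem_cyclePathIdeal_pow_iff K hm hmn hα ht)
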